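/- **Notation.** For a finite set $I$ with $N$ elements let $W(\mathsf B_N)$ be the group of signed permutations of the pairs of symbols $j^{+},j^{-}$ ($j\in I$), where $c_j$ exchanges $j^+$ and $j^-$ and a permutation $\tau$ of $I$ sends $j^\pm$ to $\tau(j)^\pm$; let $W(\mathsf D_N)$ be the subgroup of all $c_{j_1}\cdots c_{j_t}\tau$ (with $j_1,\dots,j_t$ distinct) with $t$ even. Let $\mathrm{Pic}=\mathbb Z l_{-1}\oplus\mathbb Z l_0\oplus\bigoplus_{j\in I}\mathbb Z l_j$ and $K=-2(l_{-1}+l_0)+\sum_{j} l_j$. The element $g=c_{j_1}\cdots c_{j_t}\tau\in W(\mathsf D_N)$ acts on $\mathrm{Pic}$ by $l_0\mapsto l_0$; $l_j\mapsto l_{\tau(j)}$ if $\tau(j)\notin\{j_1,\dots,j_t\}$ and $l_j\mapsto l_0-l_{\tau(j)}$ otherwise; $l_{-1}\mapsto l_{-1}+\tfrac t2 l_0-\sum_{i=1}^t l_{j_i}$. A subgroup $G\subseteq W(\mathsf D_N)$ satisfies (H1) if $\mathrm H^1(H,\mathrm{Pic})=0$ for every subgroup $H\subseteq G$, and it is relatively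 minimal if $\mathrm{Pic}^G=\mathbb Z l_0\oplus\mathbb Z K$. For $n\ge 1$ let $\mathfrak D_{2n+1}\subset W(\mathsf D_{2n+2})$, with $I=\{1,\dots,2n+2\}$, be generated by $$g_1=c_1c_2\cdots c_{2n+2}(2,3)(4,5)\cdots(2n,2n+1),\qquad g_2=(1,2,4,\dots,2n,2n+1,2n-1,\dots,3).$$ For an odd prime $p$ and $r\ge1$ write $\mathbb F_{p^r}=(\mathbb Z/p)[x]/(h)$ with $h$ monic irreducible of degree $r$, let $\Gamma$ be a generator of $\mathbb F_{p^r}^*$, and label the class of $a_0+a_1x+\dots+a_{r-1}x^{r-1}$ ($0\le a_i<p$) by $a_0+a_1p+\dots+a_{r-1}p^{r-1}$, except that the class $0$ has label $p^r$. Let $\mathfrak F_{p^r}\subset W(\mathsf D_{p^r+1})$, with $I=\{1,\dots,p^r+1\}$, be generated by $$g_1=c_1\cdots c_{p^r+1}\,(1,\mathrm{lab}(\Gamma),\dots,\mathrm{lab}(\Gamma^{p^r-2})),$$ $$g_2=(p^r,1,\dots,p-1)(p,p+1,\dots,2p-1)\cdots(p^r-p,\dots,p^r-1).$$ In each of these groups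 the last index is an orbit of length one of the action on $I$. Given two such groups $G\subset W(\mathsf D_{m+1})$ and $G'\subset W(\mathsf D_{m'+1})$, take the disjoint union of the two index sets with the two last indices identified, and let $G$ and $G'$ act on the $m+m'+1$ resulting pairs, each acting trivially on the pairs coming only from the other one. **Theorem.** For all integers $n,n_1,n_2,r\ge1$, all odd primes $p$, and all choices of $h$ and $\Gamma$, let $(G,G')$ be $(\mathfrak D_{2n_1+1},\mathfrak D_{2n_2+1})$ or $(\mathfrak D_{2n+1},\mathfrak F_{p^r})$. Then the subgroup generated by $G$ and $G'$ is the direct product $G\times G'$ (that is, $(g,g')\mapsto gg'$ is an isomorphism from $G\times G'$ onto it), it is contained in $W(\mathsf D_{m+m'+1})$, and it satisfies (H1) and is relatively minimal. -/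

import Mathlib

open Equiv

noncomputable section

namespace ConicBundle

/-! ### Signed permutations -/

/-- The group `W(B_ι)` of signed permutations of the finite index set `ι`, the automorphism group
of the pairs of symbols `j⁺, j⁻` with `j ∈ ι`. The element `⟨s, τ⟩` is `c_{j₁} ⋯ c_{jₜ} τ`, where
`j₁, …, jₜ` are the indices at which `s` is `-1`: it sends `j^±` to `(τ j)^{± s (τ j)}`.
The product is the one with `τ c_j = c_{τ(j)} τ`. -/
abbrev WB (ι : Type) : Type := (ι → ℤˣ) ⋊[mulAutArrow] Perm ι

/-- The character `σ(c_{j₁} ⋯ c_{jₜ} τ) = (-1)ᵗ`. -/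
def signChar (ι : Type) [Fintype ι] : WB ι →* ℤˣ where
  toFun g := ∏ i, g.left i
  map_one' := by simp
  map_mul' g h := by
    simp only [SemidirectProduct.mul_left, Pi.mul_apply, Finset.prod_mul_distrib]
    congr 1
    exact Equiv.prod_comp (g.right⁻¹ : Perm ι) h.left

/-- The Weyl group `W(D_ι)`: signed permutations with an even number of minus signs. -/
def WD (ι : Type) [Fintype ι] : Subgroup (WB ι) := (signChar ι).ker

/-- `neg g i` is `1` if the sign of `g` at `i` is `-1`, and `0` otherwise. -/
def neg {ι : Type} (g : WB ι) (i : ι) : ℤ := if g.left i = -1 then 1 else 0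

/-- The number `t` of minus signs of `c_{j₁} ⋯ c_{jₜ} τ`. -/
def numNeg {ι : Type} [Fintype ι] (g : WB ι) : ℤ := ∑ i, neg g i

lemma left_eq {ι : Type} (g : WB ι) (i : ι) : ((g.left i : ℤˣ) : ℤ) = 1 - 2 * neg g i := by
  unfold neg
  rcases Int.units_eq_one_or (g.left i) with h | h <;> simp [h]

lemma neg_mul {ι : Type} (g h : WB ι) (i : ι) :
    neg (g * h) i =
      neg g i * ((h.left (g.right⁻¹ i) : ℤˣ) : ℤ) + neg h (g.right⁻¹ i) := by
  have h1 : (((g * h).left i : ℤˣ) : ℤ)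
      = ((g.left i : ℤˣ) : ℤ) * ((h.left (g.right⁻¹ i) : ℤˣ) : ℤ) := by
    rw [← Units.val_mul]; rfl
  have h2 := left_eq (g * h) i
  have h3 := left_eq g i
  have h4 := left_eq h (g.right⁻¹ i)
  rw [h1, h3, h4] at h2
  rw [h4]
  linarith

lemma numNeg_even {ι : Type} [Fintype ι] {g : WB ι} (hg : g ∈ WD ι) : 2 ∣ numNeg g := by
  have h1 : ∏ i, g.left i = 1 := hg
  have h2 : ∀ i, g.left i = if g.left i = -1 then -1 else 1 := by
    intro i
    rcases Int.units_eq_one_or (g.left i) with h | h <;> simp [h]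
  rw [Finset.prod_congr rfl (fun i _ => h2 i), Finset.prod_ite] at h1
  simp only [Finset.prod_const, mul_one, one_pow] at h1
  have h3 := (neg_one_pow_eq_one_iff_even (R := ℤˣ) (by decide)).1 h1
  have h4 : numNeg g = ((Finset.univ.filter fun i => g.left i = -1).card : ℤ) := by
    simp [numNeg, neg]
  rw [h4]
  exact_mod_cast h3.two_dvd

/-! ### The Picard lattice with its action of `W(D_ι)` -/

/-- The geometric Picard lattice of a conic bundle whose degenerate fibres are indexed by `ι`.
`(a, b, x)` stands for `a l₋₁ + b l₀ + ∑ᵢ xᵢ lᵢ`; `l₀` is the class of a fibre, and `lᵢ` and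
`l₀ - lᵢ` are the two components of the degenerate fibre with index `i`. -/
abbrev Pic (ι : Type) : Type := ℤ × ℤ × (ι → ℤ)

/-- The class `l₀` of a fibre. -/
def fiberClass (ι : Type) : Pic ι := (0, 1, 0)

/-- The canonical class `K = -2 (l₋₁ + l₀) + ∑ᵢ lᵢ`. -/
def canonicalClass (ι : Type) : Pic ι := (-2, -2, fun _ => 1)

/-- The linear map given by a signed permutation `g = c_{j₁} ⋯ c_{jₜ} τ`, `t` even:
* `l₀ ↦ l₀`;
* `lⱼ ↦ l_{τ j}` if the sign of `g` at `τ j` is `1`, and `lⱼ ↦ l₀ - l_{τ j}` if it is `-1`;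
* `l₋₁ ↦ l₋₁ + (t / 2) l₀ - (l_{j₁} + ⋯ + l_{jₜ})`. -/
def picMap {ι : Type} [Fintype ι] (g : WB ι) : Pic ι →ₗ[ℤ] Pic ι where
  toFun v := (v.1,
    v.2.1 + v.1 * (numNeg g / 2) + ∑ i, neg g i * v.2.2 (g.right⁻¹ i),
    fun i => ((g.left i : ℤˣ) : ℤ) * v.2.2 (g.right⁻¹ i) - v.1 * neg g i)
  map_add' v w := by
    refine Prod.ext rfl (Prod.ext ?_ (funext fun i => ?_))
    · simp only [Prod.fst_add, Prod.snd_add, Pi.add_apply, mul_add, Finset.sum_add_distrib]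
      ring
    · simp only [Prod.fst_add, Prod.snd_add, Pi.add_apply]
      ring
  map_smul' c v := by
    refine Prod.ext rfl (Prod.ext ?_ (funext fun i => ?_))
    · simp only [Prod.smul_fst, Prod.smul_snd, Pi.smul_apply, smul_eq_mul, RingHom.id_apply,
        mul_add, Finset.mul_sum, mul_assoc]
      congr 1
      exact Finset.sum_congr rfl fun i _ => by ring
    · simp only [Prod.smul_fst, Prod.smul_snd, Pi.smul_apply, smul_eq_mul, RingHom.id_apply]
      ring

/-- The integral representation of `W(D_ι)` on the Picard lattice. -/
def picRep (ι : Type) [Fintype ι] : Representation ℤ (WD ι) (Pic ι) where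
  toFun g := picMap (g : WB ι)
  map_one' := by
    refine LinearMap.ext fun v => Prod.ext rfl (Prod.ext ?_ (funext fun i => ?_)) <;>
      simp [picMap, numNeg, neg]
  map_mul' g h := by
    obtain ⟨g, hg⟩ := g
    obtain ⟨h, hh⟩ := h
    have hgh : g * h ∈ WD ι := mul_mem hg hh
    obtain ⟨a, ha⟩ := numNeg_even hg
    obtain ⟨b, hb⟩ := numNeg_even hh
    obtain ⟨c, hc⟩ := numNeg_even hgh
    have hre : ∀ f : ι → ℤ, ∑ i, f (g.right⁻¹ i) = ∑ i, f i :=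
      fun f => Equiv.sum_comp (g.right⁻¹ : Perm ι) f
    have key : c = a + b - ∑ i, neg g i * neg h (g.right⁻¹ i) := by
      have e : numNeg (g * h)
          = numNeg g + numNeg h - 2 * ∑ i, neg g i * neg h (g.right⁻¹ i) := by
        simp only [numNeg, neg_mul, left_eq]
        rw [← hre (neg h), Finset.mul_sum, ← Finset.sum_add_distrib, ← Finset.sum_sub_distrib]
        exact Finset.sum_congr rfl fun i _ => by ring
      linarith
    refine LinearMap.ext fun v => Prod.ext rfl (Prod.ext ?_ (funext fun i => ?_))
    · have e1 : ∑ i, neg (g * h) i * v.2.2 ((g * h).right⁻¹ i)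
          = ∑ i, neg g i * (((h.left (g.right⁻¹ i) : ℤˣ) : ℤ) * v.2.2 (h.right⁻¹ (g.right⁻¹ i)))
            + ∑ i, neg h i * v.2.2 (h.right⁻¹ i) := by
        rw [← hre (fun i => neg h i * v.2.2 (h.right⁻¹ i)), ← Finset.sum_add_distrib]
        refine Finset.sum_congr rfl fun i _ => ?_
        rw [neg_mul, SemidirectProduct.mul_right, mul_inv_rev, Perm.mul_apply]
        ring
      simp only [picMap, Subgroup.coe_mul, Module.End.mul_apply, LinearMap.coe_mk, AddHom.coe_mk]
      rw [e1, hc, ha, hb]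
      simp only [mul_sub, Finset.sum_sub_distrib, Int.mul_ediv_cancel_left _ (two_ne_zero' ℤ)]
      have e2 : ∑ i, neg g i * (v.1 * neg h (g.right⁻¹ i))
          = v.1 * ∑ i, neg g i * neg h (g.right⁻¹ i) := by
        rw [Finset.mul_sum]
        exact Finset.sum_congr rfl fun i _ => by ring
      rw [e2, key]
      ring
    · have e0 : (((g * h).left i : ℤˣ) : ℤ)
          = ((g.left i : ℤˣ) : ℤ) * ((h.left (g.right⁻¹ i) : ℤˣ) : ℤ) := by
        rw [← Units.val_mul]; rfl
      simp only [picMap, Subgroup.coe_mul, Module.End.mul_apply, LinearMap.coe_mk, AddHom.coe_mk]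
      rw [e0, neg_mul, SemidirectProduct.mul_right, mul_inv_rev, Perm.mul_apply]
      simp only [left_eq]
      ring

/-! ### The two conditions -/

/-- Condition (H1): `H¹(H, Pic) = 0` for all subgroups `H` of `G`. -/
def SatisfiesH1 {ι : Type} [Fintype ι] (G : Subgroup (WD ι)) : Prop :=
  ∀ H : Subgroup (WD ι), H ≤ G →
    Subsingleton (groupCohomology.H1 (Rep.of ((picRep ι).comp H.subtype)))

/-- Relative minimality: `Pic^G = ℤ l₀ ⊕ ℤ K`. -/
def IsRelativelyMinimal {ι : Type} [Fintype ι] (G : Subgroup (WD ι)) : Prop :=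
  Representation.invariants ((picRep ι).comp G.subtype) =
    Submodule.span ℤ {fiberClass ι, canonicalClass ι}

/-! ### The dihedral group `𝔇_{2n+1}`

Its index set is `Option (Fin (2n+1))`. The index `j ∈ {1, …, 2n+1}` is the element `j - 1` of
`Fin (2n+1)`, and the last index `2n+2`, the orbit of length one, is `none`. -/

/-- The product `c₁ c₂ ⋯ τ` of all `c_j` with the permutation `τ` of the indices other than the
last one. -/
def allSigns {M : Type} (τ : Perm M) : WB (Option M) := ⟨fun _ => -1, optionCongr τ⟩

/-- A permutation `τ` of the indices other than the last one, as a signed permutation. -/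
def noSigns {M : Type} (τ : Perm M) : WB (Option M) := ⟨1, optionCongr τ⟩

/-- The permutation `(2,3)(4,5)⋯(2n,2n+1)`, with indices lowered by one. -/
def dihedralPerm₁ (n : ℕ) : Perm (Fin (2 * n + 1)) :=
  Function.Involutive.toPerm
    (fun i => if (i : ℕ) = 0 then i
      else if h : (i : ℕ) % 2 = 1 then ⟨i + 1, by omega⟩ else ⟨i - 1, by omega⟩)
    (by
      intro i
      by_cases h0 : (i : ℕ) = 0
      · simp [h0]
      by_cases h1 : (i : ℕ) % 2 = 1
      · have h2 : ¬ ((i : ℕ) + 1) % 2 = 1 := by omega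
        ext; simp [h0, h1, h2]
      · have h2 : ((i : ℕ) - 1) % 2 = 1 := by omega
        have h3 : ¬ ((i : ℕ) - 1 = 0) := by omega
        ext; simp [h0, h1, h2, h3]; omega)

/-- The permutation `(1,2,4,…,2n,2n+1,2n-1,…,3)`, with indices lowered by one. -/
def dihedralPerm₂ (n : ℕ) : Perm (Fin (2 * n + 1)) :=
  List.formPerm
    (List.ofFn (fun k : Fin (2 * n + 1) =>
      if h : (k : ℕ) = 0 then k
      else if h' : (k : ℕ) ≤ n then ⟨2 * k - 1, by omega⟩
      else ⟨2 * (2 * n + 1 - k), by omega⟩))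

/-- `g₁ = c₁ c₂ ⋯ c_{2n+2} (2,3)(4,5)⋯(2n,2n+1)`. -/
def dihedralGen₁ (n : ℕ) : WB (Option (Fin (2 * n + 1))) := allSigns (dihedralPerm₁ n)

/-- `g₂ = (1,2,4,…,2n,2n+1,2n-1,…,3)`. -/
def dihedralGen₂ (n : ℕ) : WB (Option (Fin (2 * n + 1))) := noSigns (dihedralPerm₂ n)

/-- The group `𝔇_{2n+1}`. -/
def dihedral (n : ℕ) : Subgroup (WB (Option (Fin (2 * n + 1)))) :=
  Subgroup.closure {dihedralGen₁ n, dihedralGen₂ n}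

/-! ### The Frobenius group `𝔉_{p^r}`

The field with `p^r` elements is `(ℤ/p)[x]/(h)`, with `h` monic irreducible of degree `r`, and
`Γ` is a generator of its group of units. The index set is `Option (Fin (p^r))`. The index
`j ∈ {1, …, p^r - 1}` is the element `j` of `Fin (p^r)`, the index `p^r` is the element `0` of
`Fin (p^r)`, and the last index `p^r + 1`, the orbit of length one, is `none`. -/

section Frobenius

open Polynomial

/-- The labelling `[a₀ + a₁ x + ⋯ + a_{r-1} x^{r-1}] ↦ a₀ + a₁ p + ⋯ + a_{r-1} p^{r-1}`, with
`0 ≤ aᵢ < p`, where the label `0` stands for the index `p^r`. -/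
def lab (p : ℕ) [NeZero p] {h : (ZMod p)[X]} (hm : h.Monic) :
    AdjoinRoot h ≃ Fin (p ^ h.natDegree) :=
  ((AdjoinRoot.powerBasisAux' hm).equivFun.toEquiv.trans
    (Equiv.piCongrRight fun _ => (ZMod.finEquiv p).symm.toEquiv)).trans finFunctionFinEquiv

/-- The cycle `(lab 1, lab Γ, lab Γ², …)`: multiplication by `Γ` on labels. -/
def frobeniusPerm₁ (p : ℕ) [NeZero p] {h : (ZMod p)[X]} (hm : h.Monic) (Γ : (AdjoinRoot h)ˣ) :
    Perm (Fin (p ^ h.natDegree)) :=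
  (lab p hm).permCongr Γ.mulLeft

/-- The permutation `(p^r,1,…,p-1)(p,p+1,…,2p-1)⋯(p^r-p,…,p^r-1)`, where the index `p^r` is written
as `0`: on each block `{k p, …, k p + p - 1}` it is the cyclic shift by one. -/
def frobeniusPerm₂ (p r : ℕ) (hr : 0 < r) : Perm (Fin (p ^ r)) :=
  ((finProdFinEquiv (m := p ^ (r - 1)) (n := p)).trans
    (finCongr (pow_sub_one_mul hr.ne' p))).permCongr
    (Equiv.prodCongr (Equiv.refl _) (finRotate p))

/-- `g₁ = c₁ ⋯ c_{p^r+1} (1, lab Γ, …, lab Γ^{p^r-2})`. -/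
def frobeniusGen₁ (p : ℕ) [NeZero p] {h : (ZMod p)[X]} (hm : h.Monic) (Γ : (AdjoinRoot h)ˣ) :
    WB (Option (Fin (p ^ h.natDegree))) :=
  allSigns (frobeniusPerm₁ p hm Γ)

/-- `g₂ = (p^r,1,…,p-1)(p,p+1,…,2p-1)⋯(p^r-p,…,p^r-1)`. -/
def frobeniusGen₂ (p r : ℕ) (hr : 0 < r) : WB (Option (Fin (p ^ r))) :=
  noSigns (frobeniusPerm₂ p r hr)

/-- The group `𝔉_{p^r}`, where `r` is the degree of `h`. -/
def frobenius (p : ℕ) [NeZero p] {h : (ZMod p)[X]} (hm : h.Monic) (hr : 0 < h.natDegree)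
    (Γ : (AdjoinRoot h)ˣ) : Subgroup (WB (Option (Fin (p ^ h.natDegree)))) :=
  Subgroup.closure {frobeniusGen₁ p hm Γ, frobeniusGen₂ p h.natDegree hr}

end Frobenius

/-! ### Products with identified orbits of length one -/

/-- Extension of signed permutations along an injection of index sets, by the identity on the
indices outside the image. -/
def extend {ι κ : Type} (f : ι ↪ κ) : WB ι →* WB κ :=
  SemidirectProduct.map (Function.ExtendByOne.hom ℤˣ f) (Perm.viaEmbeddingHom f) (by
    intro τ
    refine MonoidHom.ext fun s => funext fun k => ?_
    have hv : ∀ i, (Perm.viaEmbeddingHom f τ)⁻¹ (f i) = f (τ⁻¹ i) := by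
      intro i
      rw [← map_inv, Perm.viaEmbeddingHom_apply, Perm.viaEmbedding_apply]
    change Function.extend f (fun i => s (τ⁻¹ i)) 1 k
      = Function.extend f s 1 ((Perm.viaEmbeddingHom f τ)⁻¹ k)
    by_cases hk : ∃ i, f i = k
    · obtain ⟨i, rfl⟩ := hk
      rw [hv, f.injective.extend_apply, f.injective.extend_apply]
    · have : (Perm.viaEmbeddingHom f τ)⁻¹ k = k := by
        rw [← map_inv, Perm.viaEmbeddingHom_apply,
          Perm.viaEmbedding_apply_of_notMem _ _ _ (by simpa using hk)]
      rw [this, Function.extend_apply' _ _ _ hk, Function.extend_apply' _ _ _ hk])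

/-- Two index sets `Option M` and `Option M'` are glued along their last indices `none` to the
index set `Option (M ⊕ M')`. This is the extension of signed permutations of the first one. -/
def glueLeft (M M' : Type) : WB (Option M) →* WB (Option (M ⊕ M')) :=
  extend (Function.Embedding.optionMap Function.Embedding.inl)

/-- The extension of signed permutations of the second index set. -/
def glueRight (M M' : Type) : WB (Option M') →* WB (Option (M ⊕ M')) :=
  extend (Function.Embedding.optionMap Function.Embedding.inr)

/-- The group generated by `G` and `G'` after identification of their last indices. -/
def gluedProduct {M M' : Type} (G : Subgroup (WB (Option M))) (G' : Subgroup (WB (Option M'))) :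
    Subgroup (WB (Option (M ⊕ M'))) :=
  G.map (glueLeft M M') ⊔ G'.map (glueRight M M')

/-- The glued group is the direct product of `G` and `G'`. -/
def IsDirectProduct {M M' : Type} (G : Subgroup (WB (Option M)))
    (G' : Subgroup (WB (Option M'))) : Prop :=
  ∃ e : G × G' ≃* gluedProduct G G', ∀ (g : G) (g' : G'),
    ((e (g, g') : gluedProduct G G') : WB (Option (M ⊕ M')))
      = glueLeft M M' g * glueRight M M' g'

end ConicBundle

end

open Equiv

namespace ConicBundle

/-! ### Cocycles with values in a signed permutation module -/

section Block

variable {H M : Type*} [Group H] [MulAction H M]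

/-! Under a suitable labelling by a ring, each factor becomes a group of maps `y ↦ γ ^ k * y + b`
whose signs all equal `(-1) ^ k`. Since `γ ^ k - 1` is a unit for odd `k`, an element of sign `-1`
has at most one fixed index besides the last one. The ring is `ℤ/(2n+1)` with `γ = -1` for the
dihedral group, and the finite field with `γ = Γ` for the Frobenius group (`isAffinePair_dihedral`,
`isAffinePair_frobenius`).

After gluing there are three invariant blocks of odd size: the two sets of proper indices and the
common last index. Signs are constant on each block, and the sign at the last index is the product
of the other two. This structure passes to subgroups, so (H1) reduces to showing that every cocycle
`f` is a coboundary (`exists_coboundary`).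

The `l₋₁`-coordinate of `f` is a homomorphism from a finite group to `ℤ`, hence zero. On each block,
the `lᵢ`-coordinates form a cocycle in a signed permutation module, and twice it is the coboundary
of some `Y`. A Sylow argument puts all indices fixed by elements of sign `-1` into one orbit of the
block (`exists_orbit_of_fixed`); on other orbits the values of `Y` are free, so `Y` can be made
constant modulo `2` on the block (`exists_hasParity`). Evenness of the `l₀`-coordinate of `2 f`
forces these parities to agree on any two blocks that change sign together, so one parity `ε` serves
all three (`exists_common_parity`). Adding a combination of the invariant classes `K` and `l₀` then
makes `(0, 0, Y)` divisible by `2`, and half of it bounds `f`.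

For relative minimality, an invariant vector satisfies `2 xᵢ + a = 0` at the indices fixed by the
generators with signs. The generators carry this equation to every index, leaving only combinations
of `K` and `l₀`. -/

/-- If every element of sign `-1` has at most one fixed point on a set of odd cardinality, then all
points fixed by elements of sign `-1` lie in one orbit. -/
theorem exists_orbit_of_fixed [Finite H] [Finite M] (χ : H →* ℤˣ) (hodd : Odd (Nat.card M))
    (hfix : ∀ h, χ h = -1 → ∀ i j : M, h • i = i → h • j = j → i = j) :
    ∃ z : M, ∀ (i : M) (h : H), χ h = -1 → h • i = i → ∃ g : H, g • z = i := by
  have : Fact (Nat.Prime 2) := ⟨Nat.prime_two⟩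
  let P : Sylow 2 H := default
  obtain ⟨z, hz⟩ := P.2.nonempty_fixed_point_of_prime_not_dvd_card M
    (by rw [← even_iff_two_dvd, Nat.not_even_iff_odd]; exact hodd)
  refine ⟨z, fun i h hχ hi => ?_⟩
  -- Raising `h` to the odd part `m` of its order gives an element of 2-power order that still has
  -- sign `-1` and still fixes `i`. A conjugate of it lies in `P`, so it also fixes a translate of
  -- `z`; uniqueness identifies that translate with `i`.
  obtain ⟨k, m, hm, hkm⟩ := Nat.exists_eq_two_pow_mul_odd (orderOf_pos h).ne'
  have hpow : (h ^ m) ^ 2 ^ k = 1 := by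
    rw [← pow_mul, mul_comm, ← hkm, pow_orderOf_eq_one]
  have hpg : IsPGroup 2 (Subgroup.zpowers (h ^ m)) := by
    obtain ⟨l, -, hl⟩ := (Nat.dvd_prime_pow Nat.prime_two).1 (orderOf_dvd_of_pow_eq_one hpow)
    exact IsPGroup.of_card (n := l) (by rw [Nat.card_zpowers, hl])
  obtain ⟨Q, hQ⟩ := hpg.exists_le_sylow
  obtain ⟨g, hg⟩ := MulAction.exists_smul_eq H P Q
  have hmem : h ^ m ∈ (Q : Subgroup H) := hQ (Subgroup.mem_zpowers _)
  rw [← hg, Sylow.coe_subgroup_smul, Subgroup.mem_pointwise_smul_iff_inv_smul_mem] at hmem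
  have hz' := hz ⟨_, hmem⟩
  have hgz : (h ^ m) • (g • z) = g • z := by
    have h1 : (g⁻¹ * h ^ m * g) • z = z := by
      simpa only [Subgroup.smul_def, MulAut.smul_def, ← map_inv, MulAut.conj_apply, inv_inv]
        using hz'
    rw [mul_smul, mul_smul, inv_smul_eq_iff] at h1
    exact h1
  have hχm : χ (h ^ m) = -1 := by rw [map_pow, hχ, hm.neg_one_pow]
  have him : ∀ n : ℕ, h ^ n • i = i := fun n => by
    induction n with
    | zero => simp
    | succ n ih => rw [pow_succ, mul_smul, hi, ih]
  exact ⟨g, hfix _ hχm _ _ hgz (him m)⟩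

variable {χ : H →* ℤˣ} {x : H → M → ℤ}

lemma cocycle_one (hx : ∀ g h i, x (g * h) i = x g i + χ g * x h (g⁻¹ • i)) (i : M) :
    x 1 i = 0 := by
  have := hx 1 1 i
  simp at this
  exact this

/-- On the powers of `u` the cocycle at `r` is additive, and `u` has finite order while `ℤ` is
torsion-free. -/
lemma cocycle_eq_zero_of_fixed [Finite H]
    (hx : ∀ g h i, x (g * h) i = x g i + χ g * x h (g⁻¹ • i)) {u : H} {r : M} (hu : u • r = r)
    (hχ : χ u = 1) : x u r = 0 := by
  have hui : u⁻¹ • r = r := by rw [inv_smul_eq_iff, hu]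
  have hn : ∀ n : ℕ, x (u ^ n) r = n * x u r := fun n => by
    induction n with
    | zero => simpa using cocycle_one hx r
    | succ n ih => rw [pow_succ', hx, hui, hχ, ih]; push_cast; ring
  have h := hn (Nat.card H)
  rw [pow_card_eq_one', cocycle_one hx] at h
  rcases mul_eq_zero.1 h.symm with h | h
  · exact absurd (by exact_mod_cast h) (Nat.card_pos (α := H)).ne'
  · exact h

/-- On the stabilizer of `r` this is a cocycle in `ℤ` twisted by `χ`. It vanishes on the kernel of
`χ` and takes a single value on the elements of sign `-1`, so its double is a coboundary. -/
lemma exists_value_at [Finite H] (hx : ∀ g h i, x (g * h) i = x g i + χ g * x h (g⁻¹ • i))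
    (r : M) :
    ∃ c : ℤ, ∀ u : H, u • r = r → 2 * x u r = ((χ u : ℤ) - 1) * c := by
  by_cases hs : ∃ u₀ : H, u₀ • r = r ∧ χ u₀ = -1
  · obtain ⟨u₀, h₀, hχ₀⟩ := hs
    refine ⟨-x u₀ r, fun u hu => ?_⟩
    rcases Int.units_eq_one_or (χ u) with h | h
    · rw [cocycle_eq_zero_of_fixed hx hu h, h]; simp
    · have h1 : x (u * u₀) r = 0 :=
        cocycle_eq_zero_of_fixed hx (by rw [mul_smul, h₀, hu]) (by rw [map_mul, h, hχ₀]; rfl)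
      rw [hx, show u⁻¹ • r = r by rw [inv_smul_eq_iff, hu], h] at h1
      rw [h]
      push_cast at h1 ⊢
      linarith
  · push Not at hs
    refine ⟨0, fun u hu => ?_⟩
    rw [cocycle_eq_zero_of_fixed hx hu ((Int.units_eq_one_or _).resolve_right (hs u hu))]
    simp

/-- Twice a cocycle is a coboundary, with prescribed values at representatives of the orbits. -/
lemma exists_of_values (hx : ∀ g h i, x (g * h) i = x g i + χ g * x h (g⁻¹ • i))
    (c : M → ℤ) (hc : ∀ r (u : H), u • r = r → 2 * x u r = ((χ u : ℤ) - 1) * c r) :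
    ∃ Y : M → ℤ, (∀ h i, 2 * x h i = χ h * Y (h⁻¹ • i) - Y i) ∧
      ∀ i, ∃ g : H, ∃ r, g • r = i ∧ 2 ∣ Y i - c r := by
  let q : M → MulAction.orbitRel.Quotient H M := fun i => Quotient.mk _ i
  have hq : ∀ i, ∃ k : H, k • (q i).out = i := fun i =>
    MulAction.orbitRel_apply.1 ((MulAction.orbitRel H M).symm
      (Quotient.mk_out (s := MulAction.orbitRel H M) i))
  choose k hk using hq
  have hqs : ∀ (h : H) i, q (h • i) = q i := fun h i => Quotient.sound ⟨h, rfl⟩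
  -- The value at the orbit representative is transported to `i` along the chosen `k i`. The sign
  -- and the term `2 * x` do not affect it modulo `2`, so the parity of `c` spreads over the whole
  -- orbit.
  refine ⟨fun i => χ (k i) * c (q i).out - 2 * x (k i) i, fun h i => ?_, fun i =>
    ⟨k i, _, hk i, ?_⟩⟩
  · set r := (q i).out with hr
    have hr' : (q (h⁻¹ • i)).out = r := by rw [hqs]
    have hk' := hk (h⁻¹ • i)
    rw [hr'] at hk'
    have hki : k i • r = i := hk i
    dsimp only
    rw [hr']
    set k' := k (h⁻¹ • i)
    set k₀ := k i
    have hu : (k₀⁻¹ * (h * k')) • r = r := by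
      rw [mul_smul, mul_smul, hk', smul_inv_smul, inv_smul_eq_iff, hki]
    have h1 := hx h k' i
    have h2 := hx k₀ (k₀⁻¹ * (h * k')) i
    rw [mul_inv_cancel_left, show k₀⁻¹ • i = r by rw [inv_smul_eq_iff, hki]] at h2
    have h3 := hc r _ hu
    have h4 : (χ h : ℤ) * χ k' = χ k₀ * χ (k₀⁻¹ * (h * k')) := by
      rw [← Units.val_mul, ← Units.val_mul, ← map_mul, ← map_mul, mul_inv_cancel_left]
    linear_combination (-c r) * h4 + (-2) * h1 + 2 * h2 + (χ k₀ : ℤ) * h3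
  · dsimp only
    rcases Int.units_eq_one_or (χ (k i)) with h | h <;> rw [h]
    · exact ⟨-x (k i) i, by push_cast; ring⟩
    · exact ⟨-c (q i).out - x (k i) i, by push_cast; ring⟩

/-- The parity `ε` is available for the cocycle `x` if `2 x` is the coboundary of a vector all of
whose entries are congruent to `ε` modulo `2`. -/
def HasParity (χ : H →* ℤˣ) (x : H → M → ℤ) (ε : ℤ) : Prop :=
  ∃ Y : M → ℤ, (∀ i, 2 ∣ Y i - ε) ∧ ∀ h i, 2 * x h i = χ h * Y (h⁻¹ • i) - Y i

/-- With trivial signs the cocycle vanishes on all stabilizers, so the values at representatives are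
unconstrained. -/
theorem hasParity_of_trivial [Finite H]
    (hx : ∀ g h i, x (g * h) i = x g i + χ g * x h (g⁻¹ • i)) (hχ : ∀ h, χ h = 1) (ε : ℤ) :
    HasParity χ x ε := by
  obtain ⟨Y, hY, hp⟩ := exists_of_values hx (fun _ => ε) fun r u hu => by
    rw [cocycle_eq_zero_of_fixed hx hu (hχ u), hχ]; simp
  exact ⟨Y, fun i => by obtain ⟨-, -, -, h⟩ := hp i; exact h, hY⟩

theorem exists_hasParity [Finite H] [Finite M] (hodd : Odd (Nat.card M))
    (hfix : ∀ h, χ h = -1 → ∀ i j : M, h • i = i → h • j = j → i = j)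
    (hx : ∀ g h i, x (g * h) i = x g i + χ g * x h (g⁻¹ • i)) : ∃ ε, HasParity χ x ε := by
  classical
  obtain ⟨z, hz⟩ := exists_orbit_of_fixed χ hodd hfix
  obtain ⟨Y₀, hY₀, -⟩ := exists_of_values hx (fun r => (exists_value_at hx r).choose)
    fun r => (exists_value_at hx r).choose_spec
  have hsplit : ∀ r, (¬ ∃ g : H, g • z = r) → ∀ u : H, u • r = r → χ u = 1 := fun r hr u hu =>
    (Int.units_eq_one_or _).resolve_right fun h => hr (hz r u h hu)
  -- On the orbit of `z` the values of `Y₀` are kept; their parity is constant there because `2 * x`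
  -- is even and signs do not matter modulo `2`. On the other orbits all stabilizers have sign `1`,
  -- so `Y₀ z` may be prescribed.
  have hval : ∀ r (u : H), u • r = r → 2 * x u r = ((χ u : ℤ) - 1) *
      (if ∃ g : H, g • z = r then Y₀ r else Y₀ z) := fun r u hu => by
    split_ifs with h
    · rw [hY₀ u r, show u⁻¹ • r = r by rw [inv_smul_eq_iff, hu]]; ring
    · rw [cocycle_eq_zero_of_fixed hx hu (hsplit r h u hu), hsplit r h u hu]; simp
  obtain ⟨Y, hY, hp⟩ := exists_of_values hx _ hval
  refine ⟨Y₀ z, Y, fun i => ?_, hY⟩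
  obtain ⟨-, r, -, h⟩ := hp i
  split_ifs at h with hr
  · obtain ⟨g, rfl⟩ := hr
    have h1 := hY₀ g (g • z)
    rw [inv_smul_smul] at h1
    have h2 : (2 : ℤ) ∣ Y₀ (g • z) - Y₀ z := by
      rcases Int.units_eq_one_or (χ g) with h' | h' <;> rw [h'] at h1 <;> push_cast at h1 <;> omega
    omega
  · exact h

end Block

/-! ### Choosing a common parity -/

/-- Here `A k` stands for the parities available on block `k`. Each `q` has sign `-1` on no block or
on exactly two, and `hrel` makes the parities of those two agree. Blocks with trivial character
impose nothing; if all three characters are nontrivial, every block is linked to another one, and a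
graph on three vertices without isolated vertices is connected. -/
lemma exists_common_parity {Q : Type*} {χ : Fin 3 → Q → ℤˣ}
    (hχ : ∀ q, χ 0 q * χ 1 q * χ 2 q = 1) {A : Fin 3 → ℤ → Prop} (hne : ∀ k, ∃ ε, A k ε)
    (hfull : ∀ k, (∀ q, χ k q = 1) → ∀ ε, A k ε)
    (hcongr : ∀ k ε ε', 2 ∣ ε - ε' → A k ε → A k ε')
    (hrel : ∀ ε : Fin 3 → ℤ, (∀ k, A k (ε k)) →
      ∀ q, 2 ∣ ∑ k, if χ k q = -1 then ε k else 0) : ∃ ε, ∀ k, A k ε := by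
  choose ε hε using hne
  have key : ∀ q, (χ 0 q = 1 ∧ χ 1 q = 1 ∧ χ 2 q = 1) ∨
      (χ 0 q = -1 ∧ χ 1 q = -1 ∧ χ 2 q = 1 ∧ (2 : ℤ) ∣ ε 0 + ε 1) ∨
      (χ 0 q = -1 ∧ χ 1 q = 1 ∧ χ 2 q = -1 ∧ (2 : ℤ) ∣ ε 0 + ε 2) ∨
      (χ 0 q = 1 ∧ χ 1 q = -1 ∧ χ 2 q = -1 ∧ (2 : ℤ) ∣ ε 1 + ε 2) := fun q => by
    have h := hχ q
    have h' := hrel ε hε q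
    rw [Fin.sum_univ_three] at h'
    rcases Int.units_eq_one_or (χ 0 q) with h0 | h0 <;>
    rcases Int.units_eq_one_or (χ 1 q) with h1 | h1 <;>
    rcases Int.units_eq_one_or (χ 2 q) with h2 | h2 <;>
    simp [h0, h1, h2] at h h' ⊢ <;> assumption
  have hm : ∀ u : ℤˣ, u = 1 ∨ u = -1 := Int.units_eq_one_or
  have hnt : ∀ k, (∀ q, χ k q = 1) ∨ ∃ q, χ k q = -1 := fun k => by
    by_contra! h
    obtain ⟨⟨q, hq⟩, h⟩ := h
    exact (hm _).elim hq (h q)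
  have h11 : (1 : ℤˣ) ≠ -1 := by decide
  have build : ∀ e : ℤ, ((∀ q, χ 0 q = 1) ∨ 2 ∣ ε 0 - e) → ((∀ q, χ 1 q = 1) ∨ 2 ∣ ε 1 - e) →
      ((∀ q, χ 2 q = 1) ∨ 2 ∣ ε 2 - e) → ∃ ε, ∀ k, A k ε := fun e h0 h1 h2 => by
    have aux : ∀ k, ((∀ q, χ k q = 1) ∨ 2 ∣ ε k - e) → A k e := fun k h =>
      h.elim (fun h => hfull k h e) fun h => hcongr k _ _ h (hε k)
    refine ⟨e, fun k => aux k ?_⟩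
    fin_cases k <;> assumption
  rcases hnt 0 with h0 | ⟨q0, h0⟩
  · refine build (ε 1) (Or.inl h0) (Or.inr (by simp)) ?_
    rcases hnt 2 with h2 | ⟨q2, h2⟩
    · exact Or.inl h2
    · have := h0 q2
      rcases key q2 with h | h | h | h
      · exact absurd (h.2.2.symm.trans h2) h11
      · exact absurd (h.2.2.1.symm.trans h2) h11
      · exact absurd (this.symm.trans h.1) h11
      · exact Or.inr (by omega)
  · rcases hnt 1 with h1 | ⟨q1, h1⟩
    · refine build (ε 0) (Or.inr (by simp)) (Or.inl h1) ?_
      have := h1 q0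
      rcases key q0 with h | h | h | h
      · exact absurd (h.1.symm.trans h0) h11
      · exact absurd (this.symm.trans h.2.1) h11
      · exact Or.inr (by omega)
      · exact absurd (h.1.symm.trans h0) h11
    · rcases hnt 2 with h2 | ⟨q2, h2⟩
      · refine build (ε 0) (Or.inr (by simp)) ?_ (Or.inl h2)
        have := h2 q0
        rcases key q0 with h | h | h | h
        · exact absurd (h.1.symm.trans h0) h11
        · exact Or.inr (by omega)
        · exact absurd (this.symm.trans h.2.2.1) h11
        · exact absurd (h.1.symm.trans h0) h11
      · refine build (ε 0) (Or.inr (by simp)) (Or.inr ?_) (Or.inr ?_) <;>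
        · rcases key q0 with h | h | h | h <;> rcases key q1 with h' | h' | h' | h' <;>
          rcases key q2 with h'' | h'' | h'' | h'' <;>
          first
          | omega
          | (exfalso; simp_all)

/-! ### Vanishing of the first cohomology -/

/-- An additive map is a cocycle on a one-point set with trivial signs. -/
lemma eq_zero_of_map_mul {Q : Type*} [Group Q] [Finite Q] {a : Q → ℤ}
    (ha : ∀ g h, a (g * h) = a g + a h) (q : Q) : a q = 0 :=
  cocycle_eq_zero_of_fixed (M := Unit) (χ := 1) (x := fun q _ => a q) (u := q) (r := ())
    (by simpa using ha) rfl rfl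

lemma picMap_fiberClass {ι : Type} [Fintype ι] (g : WB ι) :
    picMap g (fiberClass ι) = fiberClass ι := by
  simp [picMap, fiberClass]
  rfl

lemma picMap_canonicalClass {ι : Type} [Fintype ι] {g : WB ι} (hg : g ∈ WD ι) :
    picMap g (canonicalClass ι) = canonicalClass ι := by
  obtain ⟨t, ht⟩ := numNeg_even hg
  refine Prod.ext rfl (Prod.ext ?_ (funext fun i => ?_))
  · have h : ∑ i, neg g i = 2 * t := ht
    simp [picMap, canonicalClass, ht, h]
  · simp [picMap, canonicalClass, left_eq]

/-- Modulo `2` a block of sign `-1` contributes its size times its parity, and the size is odd. -/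
lemma sum_neg_mul {ι : Type} [Fintype ι] (g : WB ι) {c : ι → Fin 3}
    (hodd : ∀ k, Odd (Nat.card {i // c i = k})) {s : Fin 3 → ℤˣ} (hs : ∀ i, g.left i = s (c i))
    (hc : ∀ i, c (g.right i) = c i) {ε : Fin 3 → ℤ} {Y : ι → ℤ} (hY : ∀ i, 2 ∣ Y i - ε (c i)) :
    2 ∣ ∑ i, neg g i * Y (g.right⁻¹ i) - ∑ k, if s k = -1 then ε k else 0 := by
  have hc' : ∀ i, c (g.right⁻¹ i) = c i := fun i => by
    rw [← hc]; simp
  have h1 : (2 : ℤ) ∣ ∑ i, neg g i * Y (g.right⁻¹ i)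
      - ∑ i, if s (c i) = -1 then ε (c i) else 0 := by
    rw [← Finset.sum_sub_distrib]
    refine Finset.dvd_sum fun i _ => ?_
    have h := hY (g.right⁻¹ i)
    rw [hc'] at h
    unfold neg
    rw [hs]
    split_ifs
    · simpa using h
    · simp
  have h2 : (2 : ℤ) ∣ (∑ i, if s (c i) = -1 then ε (c i) else 0)
      - ∑ k, if s k = -1 then ε k else 0 := by
    classical
    rw [← Finset.sum_fiberwise Finset.univ c, ← Finset.sum_sub_distrib]
    refine Finset.dvd_sum fun k _ => ?_
    rw [Finset.sum_congr rfl (g := fun _ => if s k = -1 then ε k else 0)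
      (fun i hi => by rw [(Finset.mem_filter.1 hi).2]), Finset.sum_const]
    obtain ⟨m, hm⟩ := hodd k
    rw [Nat.card_eq_fintype_card, Fintype.card_subtype] at hm
    rw [hm]
    refine ⟨m * if s k = -1 then ε k else 0, ?_⟩
    rw [nsmul_eq_mul]
    push_cast
    ring
  have := dvd_add h1 h2
  rwa [sub_add_sub_cancel] at this

/-- A finite group of signed permutations preserves three blocks of odd size, has constant signs
on each of them, and the product of these three signs is `1`. If an element with sign `-1` on a
block has at most one fixed point there, then each cocycle is a coboundary. -/
theorem exists_coboundary {ι : Type} [Fintype ι] {Q : Type*} [Group Q] [Finite Q] (φ : Q →* WD ι)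
    (c : ι → Fin 3) (hodd : ∀ k, Odd (Nat.card {i // c i = k})) (χ : Fin 3 → Q →* ℤˣ)
    (hχ : ∀ q i, (φ q : WB ι).left i = χ (c i) q)
    (hprod : ∀ q, χ 0 q * χ 1 q * χ 2 q = 1)
    (hc : ∀ q i, c ((φ q : WB ι).right i) = c i)
    (hfix : ∀ q i j, c i = c j → χ (c i) q = -1 → (φ q : WB ι).right i = i →
      (φ q : WB ι).right j = j → i = j)
    (f : Q → Pic ι) (hf : ∀ g h, f (g * h) = picMap (φ g : WB ι) (f h) + f g) :
    ∃ v : Pic ι, ∀ q, picMap (φ q : WB ι) v - v = f q := by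
  have ha : ∀ q, (f q).1 = 0 := eq_zero_of_map_mul fun g h => by
    rw [hf]; simp [picMap, add_comm]
  have hx : ∀ g h i, (f (g * h)).2.2 i
      = (f g).2.2 i + χ (c i) g * (f h).2.2 ((φ g : WB ι).right⁻¹ i) := fun g h i => by
    rw [hf]; simp [picMap, ha, hχ, add_comm]
  let act : ∀ k, MulAction Q {i // c i = k} := fun k =>
    { smul := fun q i => ⟨(φ q : WB ι).right i, by rw [hc, i.2]⟩
      one_smul := fun i => Subtype.ext (by change (φ 1 : WB ι).right i = i; simp)
      mul_smul := fun g h i => Subtype.ext (by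
        change (φ (g * h) : WB ι).right i = (φ g : WB ι).right ((φ h : WB ι).right i); simp) }
  have hinv : ∀ k (q : Q) (i : {i // c i = k}),
      ((q⁻¹ • i : {i // c i = k}) : ι) = (φ q : WB ι).right⁻¹ i := fun k q i => by
    change (φ q⁻¹ : WB ι).right i = _
    simp
  let x : ∀ k, Q → {i // c i = k} → ℤ := fun k q i => (f q).2.2 i
  have hxk : ∀ k g h i, x k (g * h) i = x k g i + χ k g * x k h (g⁻¹ • i) := fun k g h i => by
    simp only [x, hx, hinv, i.2]
  have two_f : ∀ (ε : Fin 3 → ℤ), (∀ k, HasParity (χ k) (x k) (ε k)) → ∃ Y : ι → ℤ,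
      (∀ i, 2 ∣ Y i - ε (c i)) ∧
      ∀ q, (2 : ℤ) • f q = picMap (φ q : WB ι) (0, 0, Y) - (0, 0, Y) := by
    intro ε hε
    choose Z hZ hZ' using hε
    let Y : ι → ℤ := fun i => Z (c i) ⟨i, rfl⟩
    have hYZ : ∀ k (i : {i // c i = k}), Y i = Z k i := by rintro _ ⟨i, rfl⟩; rfl
    refine ⟨Y, fun i => hZ _ _, fun q => ?_⟩
    have hx2 : ∀ q i, 2 * (f q).2.2 i = χ (c i) q * Y ((φ q : WB ι).right⁻¹ i) - Y i := by
      intro q i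
      have := hZ' (c i) q ⟨i, rfl⟩
      rw [← hYZ, ← hYZ, hinv] at this
      exact this
    have hb : ∀ q, 2 * (f q).2.1 - (picMap (φ q : WB ι) (0, 0, Y)).2.1 = 0 := by
      -- `2 f` and the coboundary of `(0, 0, Y)` agree in all other coordinates, so their difference
      -- is a cocycle with values in the invariant line `ℤ l₀`, that is, a homomorphism to `ℤ`.
      refine eq_zero_of_map_mul fun g h => ?_
      have h1 : picMap (φ (g * h) : WB ι) (0, 0, Y)
          = picMap (φ g : WB ι) (picMap (φ h : WB ι) (0, 0, Y)) := by
        rw [map_mul]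
        exact LinearMap.congr_fun ((picRep ι).map_mul (φ g) (φ h)) _
      have h2 : ∀ i, (picMap (φ h : WB ι) (0, 0, Y)).2.2 i = 2 * (f h).2.2 i + Y i := fun i => by
        rw [hx2]; simp [picMap, hχ]
      have h3 : ∀ (g : WB ι) v, (picMap g v).2.1
        = v.2.1 + v.1 * (numNeg g / 2) + ∑ i, neg g i * v.2.2 (g.right⁻¹ i) := fun _ _ => rfl
      have h4 : ∀ (g : WB ι) v, (picMap g v).1 = v.1 := fun _ _ => rfl
      rw [h1, hf, h3, Prod.snd_add, Prod.fst_add, h3, h4, h3 (φ h) (0, 0, Y),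
        h3 (φ g) (0, 0, Y), ha]
      simp only [h2, mul_add, Finset.sum_add_distrib, mul_left_comm _ (2 : ℤ), ← Finset.mul_sum]
      ring
    refine Prod.ext ?_ (Prod.ext ?_ (funext fun i => ?_))
    · simp [ha, picMap]
    · have := hb q
      simp only [Prod.smul_snd, Prod.smul_fst, smul_eq_mul, Prod.snd_sub, Prod.fst_sub]
      linarith
    · simp only [Prod.smul_snd, Pi.smul_apply, smul_eq_mul, hx2]
      simp [picMap, hχ]
  obtain ⟨ε, hε⟩ : ∃ ε, ∀ k, HasParity (χ k) (x k) ε := by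
    refine exists_common_parity (χ := fun k q => χ k q) hprod (fun k => ?_)
      (fun k hk ε => hasParity_of_trivial (hxk k) hk ε) ?_ ?_
    · refine exists_hasParity (hodd k) (fun q hq i j hi hj => Subtype.ext ?_) (hxk k)
      exact hfix q i j (i.2.trans j.2.symm) (by rw [i.2]; exact hq) (congrArg Subtype.val hi)
        (congrArg Subtype.val hj)
    · rintro k ε ε' h ⟨Y, hY, hY'⟩
      exact ⟨Y, fun i => by have := hY i; omega, hY'⟩
    -- The `l₀`-coordinate of `2 f q` is even, and modulo `2` it is the sum of the parities of the
    -- blocks where `q` has sign `-1`.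
    · intro ε hε q
      obtain ⟨Y, hY, hY'⟩ := two_f ε hε
      have h1 := sum_neg_mul (φ q : WB ι) hodd (s := fun k => χ k q) (hχ q) (hc q) hY
      have h2 : 2 * (f q).2.1 = _ := congrArg (fun v : Pic ι => v.2.1) (hY' q)
      have h3 : 2 * (f q).2.1 = ∑ i, neg (φ q : WB ι) i * Y ((φ q : WB ι).right⁻¹ i) := by
        rw [h2]; simp [picMap]
      rw [← h3] at h1
      exact (dvd_sub_right ⟨_, rfl⟩).1 h1
  obtain ⟨Y, hY, hY'⟩ := two_f (fun _ => ε) hε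
  choose X hX using hY
  -- With `Y = ε + 2 X`, this is half of `(0, 0, Y) + ε K + 2 ε l₀`, which differs from `(0, 0, Y)`
  -- by an invariant vector.
  refine ⟨(-ε, 0, fun i => X i + ε), fun q => ?_⟩
  have hv : (2 : ℤ) • ((-ε, 0, fun i => X i + ε) : Pic ι)
      = (0, 0, Y) + ε • canonicalClass ι + (2 * ε) • fiberClass ι := by
    refine Prod.ext ?_ (Prod.ext ?_ (funext fun i => ?_))
    · simp [canonicalClass, fiberClass]; ring
    · simp [canonicalClass, fiberClass]; ring
    · have := hX i
      simp [canonicalClass, fiberClass]; linarith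
  refine smul_right_injective (Pic ι) (two_ne_zero' ℤ) ?_
  change (2 : ℤ) • _ = (2 : ℤ) • _
  rw [smul_sub, ← map_smul, hv, hY', map_add, map_add, map_smul, map_smul,
    picMap_canonicalClass (φ q).2, picMap_fiberClass]
  abel

theorem subsingleton_H1_of_coboundary {Q : Type} [Group Q] {V : Type} [AddCommGroup V]
    (ρ : Representation ℤ Q V)
    (h : ∀ f : Q → V, (∀ a b, f (a * b) = ρ a (f b) + f a) → ∃ v, ∀ q, ρ q v - v = f q) :
    Subsingleton (groupCohomology.H1 (Rep.of ρ)) := by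
  refine subsingleton_of_forall_eq 0 fun y => ?_
  induction y using groupCohomology.H1_induction_on with
  | h f =>
    rw [groupCohomology.H1π_eq_zero_iff]
    obtain ⟨v, hv⟩ := h f ((groupCohomology.mem_cocycles₁_iff _).1 f.2)
    exact ⟨v, funext hv⟩

/-! ### Signed permutations glued along the last index -/

section Glue

variable {M M' : Type}

lemma extend_left_apply {ι κ : Type} (f : ι ↪ κ) (g : WB ι) (i : ι) :
    (extend f g).left (f i) = g.left i :=
  f.injective.extend_apply g.left 1 i

lemma extend_left_of_notMem {ι κ : Type} (f : ι ↪ κ) (g : WB ι) {k : κ} (hk : ¬∃ i, f i = k) :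
    (extend f g).left k = 1 :=
  Function.extend_apply' g.left (1 : κ → ℤˣ) k hk

lemma extend_right_apply {ι κ : Type} (f : ι ↪ κ) (g : WB ι) (i : ι) :
    (extend f g).right (f i) = f (g.right i) :=
  Perm.viaEmbedding_apply _ _ _

lemma extend_right_of_notMem {ι κ : Type} (f : ι ↪ κ) (g : WB ι) {k : κ} (hk : ¬∃ i, f i = k) :
    (extend f g).right k = k :=
  Perm.viaEmbedding_apply_of_notMem _ _ _ hk

@[simp] lemma glueLeft_left_none (g : WB (Option M)) :
    (glueLeft M M' g).left none = g.left none :=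
  extend_left_apply _ g none

@[simp] lemma glueLeft_left_inl (g : WB (Option M)) (i : M) :
    (glueLeft M M' g).left (some (Sum.inl i)) = g.left (some i) :=
  extend_left_apply _ g (some i)

@[simp] lemma glueLeft_left_inr (g : WB (Option M)) (j : M') :
    (glueLeft M M' g).left (some (Sum.inr j)) = 1 :=
  extend_left_of_notMem _ g (by rintro ⟨_ | i, h⟩ <;> simp at h)

@[simp] lemma glueLeft_right_none (g : WB (Option M)) :
    (glueLeft M M' g).right none = (g.right none).map Sum.inl :=
  extend_right_apply _ g none

@[simp] lemma glueLeft_right_inl (g : WB (Option M)) (i : M) :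
    (glueLeft M M' g).right (some (Sum.inl i)) = (g.right (some i)).map Sum.inl :=
  extend_right_apply _ g (some i)

@[simp] lemma glueLeft_right_inr (g : WB (Option M)) (j : M') :
    (glueLeft M M' g).right (some (Sum.inr j)) = some (Sum.inr j) :=
  extend_right_of_notMem _ g (by rintro ⟨_ | i, h⟩ <;> simp at h)

@[simp] lemma glueRight_left_none (g : WB (Option M')) :
    (glueRight M M' g).left none = g.left none :=
  extend_left_apply _ g none

@[simp] lemma glueRight_left_inr (g : WB (Option M')) (j : M') :
    (glueRight M M' g).left (some (Sum.inr j)) = g.left (some j) :=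
  extend_left_apply _ g (some j)

@[simp] lemma glueRight_left_inl (g : WB (Option M')) (i : M) :
    (glueRight M M' g).left (some (Sum.inl i)) = 1 :=
  extend_left_of_notMem _ g (by rintro ⟨_ | i, h⟩ <;> simp at h)

@[simp] lemma glueRight_right_none (g : WB (Option M')) :
    (glueRight M M' g).right none = (g.right none).map Sum.inr :=
  extend_right_apply _ g none

@[simp] lemma glueRight_right_inr (g : WB (Option M')) (j : M') :
    (glueRight M M' g).right (some (Sum.inr j)) = (g.right (some j)).map Sum.inr :=
  extend_right_apply _ g (some j)

@[simp] lemma glueRight_right_inl (g : WB (Option M')) (i : M) :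
    (glueRight M M' g).right (some (Sum.inl i)) = some (Sum.inl i) :=
  extend_right_of_notMem _ g (by rintro ⟨_ | i, h⟩ <;> simp at h)

@[simp] lemma allSigns_left (τ : Perm M) : (allSigns τ).left = fun _ => -1 := rfl

@[simp] lemma allSigns_right (τ : Perm M) : (allSigns τ).right = optionCongr τ := rfl

@[simp] lemma noSigns_left (τ : Perm M) : (noSigns τ).left = 1 := rfl

@[simp] lemma noSigns_right (τ : Perm M) : (noSigns τ).right = optionCongr τ := rfl

/-- A signed permutation with constant signs that fixes the last index, and which has at most one
other fixed index if the signs are `-1`. -/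
structure IsUniform (g : WB (Option M)) : Prop where
  left_eq_none : ∀ o, g.left o = g.left none
  right_none : g.right none = none
  eq_of_fixed : g.left none = -1 → ∀ i j : M, g.right (some i) = some i →
    g.right (some j) = some j → i = j

lemma IsUniform.exists_right_some {g : WB (Option M)} (hg : IsUniform g) (i : M) :
    ∃ j, g.right (some i) = some j := by
  rcases h : g.right (some i) with _ | j
  · rw [← hg.right_none] at h
    simpa using g.right.injective h
  · exact ⟨j, rfl⟩

variable {a : WB (Option M)} {b : WB (Option M')}

/-- The only index on which both factors may carry a sign is the last one, and `a` fixes it. Hence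
signs simply multiply in the glued product, and the two factors commute. -/
lemma glueRight_left_comp (ha : IsUniform a) (o : Option (M ⊕ M')) :
    (glueRight M M' b).left ((glueLeft M M' a).right o) = (glueRight M M' b).left o := by
  rcases o with _ | i | j
  · simp [ha.right_none]
  · obtain ⟨j, hj⟩ := ha.exists_right_some i
    simp [hj]
  · simp

lemma glueLeft_left_comp (hb : IsUniform b) (o : Option (M ⊕ M')) :
    (glueLeft M M' a).left ((glueRight M M' b).right o) = (glueLeft M M' a).left o := by
  rcases o with _ | i | j
  · simp [hb.right_none]
  · simp
  · obtain ⟨j, hj⟩ := hb.exists_right_some j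
    simp [hj]

lemma mul_left_of_comp {ι : Type} {g h : WB ι} (hgh : ∀ o, h.left (g.right o) = h.left o) (o : ι) :
    (g * h).left o = g.left o * h.left o := by
  change g.left o * h.left (g.right⁻¹ o) = _
  rw [← hgh (g.right⁻¹ o)]
  simp

lemma glue_mul_left (ha : IsUniform a) (o : Option (M ⊕ M')) :
    (glueLeft M M' a * glueRight M M' b).left o
      = (glueLeft M M' a).left o * (glueRight M M' b).left o :=
  mul_left_of_comp (glueRight_left_comp ha) o

lemma glue_commute (ha : IsUniform a) (hb : IsUniform b) :
    Commute (glueLeft M M' a) (glueRight M M' b) := by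
  refine SemidirectProduct.ext (funext fun o => ?_) (Equiv.ext fun o => ?_)
  · rw [glue_mul_left ha, mul_left_of_comp (glueLeft_left_comp hb), mul_comm]
  · rw [SemidirectProduct.mul_right, SemidirectProduct.mul_right, Perm.mul_apply, Perm.mul_apply]
    rcases o with _ | i | j
    · simp [ha.right_none, hb.right_none]
    · obtain ⟨j, hj⟩ := ha.exists_right_some i
      simp [hj]
    · obtain ⟨i, hi⟩ := hb.exists_right_some j
      simp [hi]

/-- The block of an index of the glued index set. -/
def block : Option (M ⊕ M') → Fin 3
  | some (Sum.inl _) => 0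
  | some (Sum.inr _) => 1
  | none => 2

lemma odd_card_block (hM : Odd (Nat.card M)) (hM' : Odd (Nat.card M')) (k : Fin 3) :
    Odd (Nat.card {o : Option (M ⊕ M') // block o = k}) := by
  have e0 : M ≃ {o : Option (M ⊕ M') // block o = 0} :=
    Equiv.ofBijective (fun i => ⟨some (Sum.inl i), rfl⟩)
      ⟨fun i j h => by simpa using congrArg Subtype.val h, by
        rintro ⟨_ | i | i, h⟩ <;> simp [block] at h ⊢⟩
  have e1 : M' ≃ {o : Option (M ⊕ M') // block o = 1} :=
    Equiv.ofBijective (fun i => ⟨some (Sum.inr i), rfl⟩)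
      ⟨fun i j h => by simpa using congrArg Subtype.val h, by
        rintro ⟨_ | i | i, h⟩ <;> simp [block] at h ⊢⟩
  have e2 : Unit ≃ {o : Option (M ⊕ M') // block o = 2} :=
    Equiv.ofBijective (fun _ => ⟨none, rfl⟩)
      ⟨fun i j h => rfl, by rintro ⟨_ | i | i, h⟩ <;> simp [block] at h ⊢⟩
  fin_cases k
  · exact Nat.card_congr e0 ▸ hM
  · exact Nat.card_congr e1 ▸ hM'
  · exact Nat.card_congr e2 ▸ (by simp)

/-- The signs and fixed indices of a glued product, block by block. -/
lemma glue_mul_spec (ha : IsUniform a) (hb : IsUniform b) :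
    ∃ s : Fin 3 → ℤˣ, (∀ o, (glueLeft M M' a * glueRight M M' b).left o = s (block o)) ∧
      s 0 * s 1 * s 2 = 1 ∧
      (∀ o, block ((glueLeft M M' a * glueRight M M' b).right o) = block o) ∧
      ∀ o o', block o = block o' → s (block o) = -1 →
        (glueLeft M M' a * glueRight M M' b).right o = o →
        (glueLeft M M' a * glueRight M M' b).right o' = o' → o = o' := by
  refine ⟨![a.left none, b.left none, a.left none * b.left none], fun o => ?_, ?_, fun o => ?_,
    fun o o' => ?_⟩
  · rw [glue_mul_left ha]
    rcases o with _ | i | j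
    · simp [block]
    · simp [block, ha.left_eq_none (some i)]
    · simp [block, hb.left_eq_none (some j)]
  · exact Int.units_mul_self _
  · rw [SemidirectProduct.mul_right, Perm.mul_apply]
    rcases o with _ | i | j
    · simp [ha.right_none, hb.right_none]
    · obtain ⟨j, hj⟩ := ha.exists_right_some i
      simp [hj, block]
    · obtain ⟨i, hi⟩ := hb.exists_right_some j
      simp [hi, block]
  · rw [SemidirectProduct.mul_right, Perm.mul_apply, Perm.mul_apply]
    rcases o with _ | i | j <;> rcases o' with _ | i' | j' <;> intro h hs <;>
      simp [block] at h hs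
    · simp
    · obtain ⟨i₁, hi⟩ := ha.exists_right_some i
      obtain ⟨i₁', hi'⟩ := ha.exists_right_some i'
      have := ha.eq_of_fixed hs i i'
      simpa [hi, hi'] using this
    · obtain ⟨j₁, hj⟩ := hb.exists_right_some j
      obtain ⟨j₁', hj'⟩ := hb.exists_right_some j'
      have := hb.eq_of_fixed hs j j'
      simpa [hj, hj'] using this

/-- The last index only shows the product of the two signs. Nonempty `M` and `M'` are needed to read
each sign off a block where the other factor acts trivially. -/
lemma eq_one_of_glue_mul_eq_one [Nonempty M] [Nonempty M'] (ha : IsUniform a) (hb : IsUniform b)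
    (h : glueLeft M M' a * glueRight M M' b = 1) : a = 1 ∧ b = 1 := by
  have hl : ∀ o, (glueLeft M M' a).left o * (glueRight M M' b).left o = 1 := fun o => by
    rw [← glue_mul_left ha, h]; rfl
  have hr : ∀ o, (glueLeft M M' a).right ((glueRight M M' b).right o) = o := fun o => by
    rw [← Perm.mul_apply, ← SemidirectProduct.mul_right, h]; rfl
  refine ⟨SemidirectProduct.ext (funext fun o => ?_) (Equiv.ext fun o => ?_),
    SemidirectProduct.ext (funext fun o => ?_) (Equiv.ext fun o => ?_)⟩
  · have := hl (some (Sum.inl (Classical.arbitrary M)))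
    rw [ha.left_eq_none, ← ha.left_eq_none (some (Classical.arbitrary M))]
    simpa using this
  · rcases o with _ | i
    · exact ha.right_none
    · obtain ⟨j, hj⟩ := ha.exists_right_some i
      have := hr (some (Sum.inl i))
      simpa [hj] using this
  · have := hl (some (Sum.inr (Classical.arbitrary M')))
    rw [hb.left_eq_none, ← hb.left_eq_none (some (Classical.arbitrary M'))]
    simpa using this
  · rcases o with _ | i
    · exact hb.right_none
    · obtain ⟨j, hj⟩ := hb.exists_right_some i
      have := hr (some (Sum.inr i))
      simpa [hj] using this

variable {G : Subgroup (WB (Option M))} {G' : Subgroup (WB (Option M'))}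

theorem isDirectProduct_of_isUniform [Nonempty M] [Nonempty M'] (hG : ∀ g ∈ G, IsUniform g)
    (hG' : ∀ g ∈ G', IsUniform g) : IsDirectProduct G G' := by
  let φ : G × G' →* WB (Option (M ⊕ M')) :=
    ((glueLeft M M').comp G.subtype).noncommCoprod ((glueRight M M').comp G'.subtype)
      fun g g' => glue_commute (hG g g.2) (hG' g' g'.2)
  have hφ : Function.Injective φ := by
    rw [injective_iff_map_eq_one]
    rintro ⟨g, g'⟩ h
    obtain ⟨h1, h2⟩ := eq_one_of_glue_mul_eq_one (hG g g.2) (hG' g' g'.2) h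
    exact Prod.ext (Subtype.ext h1) (Subtype.ext h2)
  have hrange : φ.range = gluedProduct G G' := by
    rw [MonoidHom.noncommCoprod_range, MonoidHom.range_comp, MonoidHom.range_comp,
      Subgroup.range_subtype, Subgroup.range_subtype]
    rfl
  exact ⟨(MonoidHom.ofInjective hφ).trans (MulEquiv.subgroupCongr hrange), fun _ _ => rfl⟩

lemma exists_of_mem_gluedProduct [Nonempty M] [Nonempty M'] (hG : ∀ g ∈ G, IsUniform g)
    (hG' : ∀ g ∈ G', IsUniform g) {x : WB (Option (M ⊕ M'))} (hx : x ∈ gluedProduct G G') :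
    ∃ g ∈ G, ∃ g' ∈ G', x = glueLeft M M' g * glueRight M M' g' := by
  obtain ⟨e, he⟩ := isDirectProduct_of_isUniform hG hG'
  obtain ⟨⟨g, g'⟩, h⟩ := e.surjective ⟨x, hx⟩
  exact ⟨g, g.2, g', g'.2, by rw [← he, h]⟩

lemma units_pow_of_odd (s : ℤˣ) {m : ℕ} (hm : Odd m) : s ^ m = s := by
  rcases Int.units_eq_one_or s with rfl | rfl
  · simp
  · exact hm.neg_one_pow

/-- Each factor has one constant sign on an odd block together with the last index, an even number
of indices. -/
theorem gluedProduct_le_WD [Fintype M] [Fintype M'] (hM : Odd (Nat.card M))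
    (hM' : Odd (Nat.card M')) (hG : ∀ g ∈ G, IsUniform g) (hG' : ∀ g ∈ G', IsUniform g) :
    gluedProduct G G' ≤ WD (Option (M ⊕ M')) := by
  rw [Nat.card_eq_fintype_card] at hM hM'
  refine sup_le ?_ ?_ <;> rintro _ ⟨g, hg, rfl⟩ <;> change ∏ o, _ = (1 : ℤˣ)
  · rw [Fintype.prod_option, Fintype.prod_sum_type]
    simp [(hG g hg).left_eq_none (some _), units_pow_of_odd _ hM, Int.units_mul_self]
  · rw [Fintype.prod_option, Fintype.prod_sum_type]
    simp [(hG' g hg).left_eq_none (some _), units_pow_of_odd _ hM', Int.units_mul_self]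

theorem satisfiesH1_of_isUniform [Fintype M] [Fintype M'] (hM : Odd (Nat.card M))
    (hM' : Odd (Nat.card M')) (hG : ∀ g ∈ G, IsUniform g) (hG' : ∀ g ∈ G', IsUniform g) :
    SatisfiesH1 ((gluedProduct G G').subgroupOf (WD _)) := by
  have : Nonempty M := (Nat.card_pos_iff.1 hM.pos).1
  have : Nonempty M' := (Nat.card_pos_iff.1 hM'.pos).1
  intro H hH
  have : Finite (WB (Option (M ⊕ M'))) := Finite.of_equiv _ SemidirectProduct.equivProd.symm
  refine subsingleton_H1_of_coboundary _ fun f hf => ?_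
  have spec : ∀ q : H, ∃ s : Fin 3 → ℤˣ,
      (∀ o, q.1.1.left o = s (block o)) ∧ s 0 * s 1 * s 2 = 1 ∧
      (∀ o, block (q.1.1.right o) = block o) ∧
      ∀ o o', block o = block o' → s (block o) = -1 →
        q.1.1.right o = o →
        q.1.1.right o' = o' → o = o' := fun q => by
    obtain ⟨g, hg, g', hg', h⟩ := exists_of_mem_gluedProduct hG hG' (hH q.2)
    rw [Subgroup.subtype_apply] at h
    rw [h]
    exact glue_mul_spec (hG g hg) (hG' g' hg')
  choose s hs hprod hblock hfix using spec
  -- Every block is nonempty, so the chosen block signs are determined by actual signs and are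
  -- therefore multiplicative.
  have hsurj : ∀ k, ∃ o : Option (M ⊕ M'), block o = k := fun k => by
    fin_cases k
    · exact ⟨some (Sum.inl (Classical.arbitrary M)), rfl⟩
    · exact ⟨some (Sum.inr (Classical.arbitrary M')), rfl⟩
    · exact ⟨none, rfl⟩
  have hsmul : ∀ k q q', s (q * q') k = s q k * s q' k := fun k q q' => by
    obtain ⟨o, rfl⟩ := hsurj k
    rw [← hs]
    change q.1.1.left o * q'.1.1.left (q.1.1.right⁻¹ o) = _
    rw [hs, hs, ← hblock q (q.1.1.right⁻¹ o)]
    simp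
  exact exists_coboundary H.subtype block (odd_card_block hM hM')
    (fun k => MonoidHom.mk' (fun q => s q k) (hsmul k)) hs hprod hblock hfix f hf

end Glue

/-! ### Groups of affine maps -/

/-- Two permutations that become `y ↦ γ y` and `y ↦ y + 1` under a bijection with a commutative
ring, where `γ ^ k - 1` is a unit for odd `k`, and such that every element of the ring is reached
from `0` by means of these two maps. -/
structure IsAffinePair {M R : Type*} [CommRing R] (γ : Rˣ) (e : M ≃ R) (τ₁ τ₂ : Perm M) :
    Prop where
  apply_mul : ∀ i, e (τ₁ i) = γ * e i
  apply_add_one : ∀ i, e (τ₂ i) = e i + 1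
  isUnit_zpow_sub_one : ∀ k : ℤ, Odd k → IsUnit (((γ ^ k : Rˣ) : R) - 1)
  mem_of_closed : ∀ A : Set R, 0 ∈ A → (∀ y ∈ A, y + 1 ∈ A) → (∀ y ∈ A, (γ : R) * y ∈ A) →
    ∀ y, y ∈ A

section Affine

variable {M R : Type} [CommRing R] {γ : Rˣ} {e : M ≃ R} {τ₁ τ₂ : Perm M}

/-- The same exponent `k` governs the multiplier and the sign; this ties sign `-1` to odd powers of
`γ`. -/
lemma IsAffinePair.exists_affine (h : IsAffinePair γ e τ₁ τ₂) {g : WB (Option M)}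
    (hg : g ∈ Subgroup.closure {allSigns τ₁, noSigns τ₂}) :
    ∃ (k : ℤ) (b : R) (τ : Perm M), (∀ i, e (τ i) = ((γ ^ k : Rˣ) : R) * e i + b) ∧
      g.left = (fun _ => (-1) ^ k) ∧ g.right = optionCongr τ := by
  induction hg using Subgroup.closure_induction with
  | mem g hg =>
    rcases hg with rfl | rfl
    · exact ⟨1, 0, τ₁, by simp [h.apply_mul], by simp, rfl⟩
    · exact ⟨0, 1, τ₂, by simp [h.apply_add_one], by ext; simp, rfl⟩
  | one => exact ⟨0, 0, 1, by simp, by ext; simp, by ext o; simp⟩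
  | mul g g' _ _ ih ih' =>
    obtain ⟨k, b, τ, hτ, hl, hr⟩ := ih
    obtain ⟨k', b', τ', hτ', hl', hr'⟩ := ih'
    refine ⟨k + k', ((γ ^ k : Rˣ) : R) * b' + b, τ * τ', fun i => ?_, funext fun o => ?_, ?_⟩
    · rw [Perm.mul_apply, hτ, hτ', zpow_add]
      push_cast
      ring
    · change g.left o * g'.left (g.right⁻¹ o) = _
      rw [hl, hl', zpow_add]
    · rw [SemidirectProduct.mul_right, hr, hr']
      ext o : 1
      rcases o with _ | i <;> rfl
  | inv g _ ih =>
    obtain ⟨k, b, τ, hτ, hl, hr⟩ := ih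
    refine ⟨-k, -(((γ ^ (-k) : Rˣ) : R) * b), τ⁻¹, fun i => ?_, funext fun o => ?_, ?_⟩
    · have h1 := hτ (τ⁻¹ i)
      rw [show τ (τ⁻¹ i) = i by simp] at h1
      rw [h1, mul_add, ← mul_assoc, ← Units.val_mul, ← zpow_add]
      simp
    · change (g.left ((g.right⁻¹)⁻¹ o))⁻¹ = _
      rw [hl, zpow_neg]
    · rw [SemidirectProduct.inv_right, hr]
      rfl

lemma IsAffinePair.isUniform (h : IsAffinePair γ e τ₁ τ₂) :
    ∀ g ∈ Subgroup.closure {allSigns τ₁, noSigns τ₂}, IsUniform g := fun g hg => by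
  obtain ⟨k, b, τ, hτ, hl, hr⟩ := h.exists_affine hg
  refine ⟨fun o => by rw [hl], by rw [hr]; rfl, fun hs i j hi hj => ?_⟩
  rw [hl] at hs
  have hk : Odd k := by
    by_contra hk
    rw [Int.not_odd_iff_even] at hk
    simp [hk.neg_one_zpow] at hs
  have hi' : τ i = i := by simpa [hr] using hi
  have hj' : τ j = j := by simpa [hr] using hj
  have hi2 := hτ i
  have hj2 := hτ j
  rw [hi'] at hi2
  rw [hj'] at hj2
  refine e.injective ((h.isUnit_zpow_sub_one k hk).mul_left_cancel ?_)
  -- Both fixed indices solve `(γ ^ k - 1) * y = -b`, whose coefficient is a unit.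
  linear_combination hj2 - hi2

/-- The equation holds at the index labelled `0`, which `τ₁` fixes, and it is preserved by both
maps. -/
lemma IsAffinePair.two_mul_add_eq_zero (h : IsAffinePair γ e τ₁ τ₂) {x : M → ℤ} {a : ℤ}
    (h₁ : ∀ i, -x i - a = x (τ₁ i)) (h₂ : ∀ i, x i = x (τ₂ i)) (i : M) : 2 * x i + a = 0 := by
  have key := h.mem_of_closed {y | 2 * x (e.symm y) + a = 0} ?_ ?_ ?_ (e i)
  · simpa using key
  · have h0 : τ₁ (e.symm 0) = e.symm 0 := e.injective (by simp [h.apply_mul])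
    have := h₁ (e.symm 0)
    rw [h0] at this
    change 2 * x (e.symm 0) + a = 0
    linarith
  · intro y hy
    have h0 : e.symm (y + 1) = τ₂ (e.symm y) := e.injective (by simp [h.apply_add_one])
    change 2 * x (e.symm (y + 1)) + a = 0
    rw [h0, ← h₂]
    exact hy
  · intro y hy
    have h0 : e.symm (γ * y) = τ₁ (e.symm y) := e.injective (by simp [h.apply_mul])
    change 2 * x (e.symm (γ * y)) + a = 0
    have hy : 2 * x (e.symm y) + a = 0 := hy
    rw [h0, ← h₁]
    linarith

lemma apply_right_of_picMap_eq {ι : Type} [Fintype ι] {g : WB ι} {v : Pic ι}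
    (h : picMap g v = v) (i : ι) :
    (g.left (g.right i) : ℤ) * v.2.2 i - v.1 * neg g (g.right i) = v.2.2 (g.right i) := by
  have := congrFun (congrArg (fun v : Pic ι => v.2.2) h) (g.right i)
  simpa [picMap] using this

variable {M' R' : Type} [CommRing R'] {γ' : R'ˣ} {e' : M' ≃ R'} {τ₁' τ₂' : Perm M'}

theorem IsAffinePair.isRelativelyMinimal [Fintype M] [Fintype M'] (hM : Odd (Nat.card M))
    (hM' : Odd (Nat.card M')) (h : IsAffinePair γ e τ₁ τ₂) (h' : IsAffinePair γ' e' τ₁' τ₂') :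
    IsRelativelyMinimal ((gluedProduct (Subgroup.closure {allSigns τ₁, noSigns τ₂})
      (Subgroup.closure {allSigns τ₁', noSigns τ₂'})).subgroupOf (WD _)) := by
  have hle := gluedProduct_le_WD hM hM' h.isUniform h'.isUniform
  refine le_antisymm (fun v hv => ?_) ?_
  · have hv' : ∀ g ∈ gluedProduct (Subgroup.closure {allSigns τ₁, noSigns τ₂})
        (Subgroup.closure {allSigns τ₁', noSigns τ₂'}), picMap g v = v := fun g hg =>
      hv ⟨⟨g, hle hg⟩, hg⟩
    have hl : ∀ g ∈ ({allSigns τ₁, noSigns τ₂} : Set _), picMap (glueLeft M M' g) v = v :=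
      fun g hg => hv' _ (Subgroup.mem_sup_left ⟨g, Subgroup.subset_closure hg, rfl⟩)
    have hr : ∀ g ∈ ({allSigns τ₁', noSigns τ₂'} : Set _), picMap (glueRight M M' g) v = v :=
      fun g hg => hv' _ (Subgroup.mem_sup_right ⟨g, Subgroup.subset_closure hg, rfl⟩)
    obtain ⟨a, b, x⟩ := v
    have hnone : 2 * x none + a = 0 := by
      have := apply_right_of_picMap_eq (hl _ (Or.inl rfl)) none
      simp [neg] at this
      linarith
    have hinl : ∀ i : M, 2 * x (some (Sum.inl i)) + a = 0 := by
      refine h.two_mul_add_eq_zero (fun i => ?_) fun i => ?_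
      · have := apply_right_of_picMap_eq (hl _ (Or.inl rfl)) (some (Sum.inl i))
        simpa [neg] using this
      · have := apply_right_of_picMap_eq (hl _ (Or.inr rfl)) (some (Sum.inl i))
        simpa [neg] using this
    have hinr : ∀ i : M', 2 * x (some (Sum.inr i)) + a = 0 := by
      refine h'.two_mul_add_eq_zero (fun i => ?_) fun i => ?_
      · have := apply_right_of_picMap_eq (hr _ (Or.inl rfl)) (some (Sum.inr i))
        simpa [neg] using this
      · have := apply_right_of_picMap_eq (hr _ (Or.inr rfl)) (some (Sum.inr i))
        simpa [neg] using this
    rw [Submodule.mem_span_pair]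
    -- The multiple of `K` is the common value of the `xᵢ`; the term `2 * x none` compensates for
    -- the `l₀`-coefficient `-2` of `K`.
    refine ⟨b + 2 * x none, x none, Prod.ext ?_ (Prod.ext ?_ (funext fun o => ?_))⟩
    · simp [fiberClass, canonicalClass]
      linarith
    · simp [fiberClass, canonicalClass]
      ring
    · simp only [fiberClass, canonicalClass, Prod.smul_mk, Prod.mk_add_mk, smul_zero, zero_add,
        Pi.smul_apply, smul_eq_mul, mul_one]
      rcases o with _ | i | i
      · rfl
      · linarith [hinl i]
      · linarith [hinr i]
  · rw [Submodule.span_le]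
    rintro v (rfl | rfl)
    · exact fun g => picMap_fiberClass _
    · exact fun g => picMap_canonicalClass g.1.2

/-- The glued product of two groups generated by affine pairs. -/
theorem IsAffinePair.gluedProduct [Fintype M] [Fintype M'] (hM : Odd (Nat.card M))
    (hM' : Odd (Nat.card M')) (h : IsAffinePair γ e τ₁ τ₂) (h' : IsAffinePair γ' e' τ₁' τ₂')
    {G : Subgroup (WB (Option M))} {G' : Subgroup (WB (Option M'))}
    (hG : G = Subgroup.closure {allSigns τ₁, noSigns τ₂})
    (hG' : G' = Subgroup.closure {allSigns τ₁', noSigns τ₂'}) :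
    IsDirectProduct G G' ∧ gluedProduct G G' ≤ WD _ ∧
      SatisfiesH1 ((gluedProduct G G').subgroupOf (WD _)) ∧
      IsRelativelyMinimal ((gluedProduct G G').subgroupOf (WD _)) := by
  subst hG hG'
  have : Nonempty M := (Nat.card_pos_iff.1 hM.pos).1
  have : Nonempty M' := (Nat.card_pos_iff.1 hM'.pos).1
  exact ⟨isDirectProduct_of_isUniform h.isUniform h'.isUniform,
    gluedProduct_le_WD hM hM' h.isUniform h'.isUniform,
    satisfiesH1_of_isUniform hM hM' h.isUniform h'.isUniform, h.isRelativelyMinimal hM hM' h'⟩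

end Affine

/-! ### The dihedral groups -/

section Dihedral

/-- The indices `1, 2, 4, …, 2n, 2n+1, 2n-1, …, 3`, lowered by one, in the order of the cycle. -/
def dihedralCycle (n : ℕ) (k : Fin (2 * n + 1)) : Fin (2 * n + 1) :=
  if h : (k : ℕ) = 0 then k
  else if h' : (k : ℕ) ≤ n then ⟨2 * k - 1, by omega⟩
  else ⟨2 * (2 * n + 1 - k), by omega⟩

lemma dihedralCycle_val (n : ℕ) (k : Fin (2 * n + 1)) : (dihedralCycle n k : ℕ) =
    if (k : ℕ) = 0 then 0 else if (k : ℕ) ≤ n then 2 * (k : ℕ) - 1 else 2 * (2 * n + 1 - k) := by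
  unfold dihedralCycle
  split_ifs <;> simp_all

lemma dihedralCycle_injective (n : ℕ) : Function.Injective (dihedralCycle n) := fun k l h => by
  have h := congrArg Fin.val h
  rw [dihedralCycle_val, dihedralCycle_val] at h
  ext
  split_ifs at h <;> omega

/-- The parametrization of the indices by `ℤ/(2n+1)` along the cycle. -/
noncomputable def dihedralEquiv (n : ℕ) : ZMod (2 * n + 1) ≃ Fin (2 * n + 1) :=
  (ZMod.finEquiv (2 * n + 1)).symm.toEquiv.trans
    (Equiv.ofBijective _ (Finite.injective_iff_bijective.1 (dihedralCycle_injective n)))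

lemma dihedralPerm₂_apply (n : ℕ) (k : Fin (2 * n + 1)) :
    dihedralPerm₂ n (dihedralCycle n k) = dihedralCycle n (k + 1) := by
  have hl : dihedralPerm₂ n = List.formPerm (List.ofFn (dihedralCycle n)) := rfl
  have h := List.formPerm_apply_getElem (List.ofFn (dihedralCycle n))
    (List.nodup_ofFn.2 (dihedralCycle_injective n)) k (by simpa using k.2)
  simp only [List.getElem_ofFn, List.length_ofFn] at h
  rw [hl]
  refine h.trans (congrArg _ (Fin.ext ?_))
  simp [Fin.val_add]

/-- For `1 ≤ k ≤ n` the positions `k` and `2n+1-k` of the cycle carry the lowered indices `2k-1` and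
`2k`, which are the pairs exchanged by `dihedralPerm₁`. -/
lemma dihedralPerm₁_apply (n : ℕ) (k : Fin (2 * n + 1)) :
    dihedralPerm₁ n (dihedralCycle n k) = dihedralCycle n (-k) := by
  have hv : ((-k : Fin (2 * n + 1)) : ℕ) = if (k : ℕ) = 0 then 0 else 2 * n + 1 - k := by
    rw [Fin.val_neg']
    split_ifs with h
    · simp [h]
    · exact Nat.mod_eq_of_lt (by omega)
  have h1 : ∀ i : Fin (2 * n + 1), (dihedralPerm₁ n i : ℕ) =
      if (i : ℕ) = 0 then 0 else if (i : ℕ) % 2 = 1 then (i : ℕ) + 1 else i - 1 := fun i => by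
    change Fin.val (if (i : ℕ) = 0 then i
      else if h : (i : ℕ) % 2 = 1 then ⟨i + 1, by omega⟩ else ⟨i - 1, by omega⟩) = _
    split_ifs <;> simp_all
  ext
  rw [h1, dihedralCycle_val, dihedralCycle_val, hv]
  have := k.2
  split_ifs <;> omega

lemma isAffinePair_dihedral (n : ℕ) :
    IsAffinePair (-1 : (ZMod (2 * n + 1))ˣ) (dihedralEquiv n).symm (dihedralPerm₁ n)
      (dihedralPerm₂ n) where
  apply_mul i := by
    obtain ⟨y, rfl⟩ := (dihedralEquiv n).surjective i
    rw [Equiv.symm_apply_eq, Equiv.symm_apply_apply]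
    simpa [dihedralEquiv] using
      dihedralPerm₁_apply n ((ZMod.finEquiv (2 * n + 1)).symm y)
  apply_add_one i := by
    obtain ⟨y, rfl⟩ := (dihedralEquiv n).surjective i
    rw [Equiv.symm_apply_eq, Equiv.symm_apply_apply]
    simpa [dihedralEquiv] using
      dihedralPerm₂_apply n ((ZMod.finEquiv (2 * n + 1)).symm y)
  isUnit_zpow_sub_one k hk := by
    rw [hk.neg_one_zpow]
    have h2 : IsUnit ((2 : ℕ) : ZMod (2 * n + 1)) :=
      (ZMod.isUnit_iff_coprime _ _).2 (by simp)
    have h3 : (((-1 : (ZMod (2 * n + 1))ˣ) : ZMod (2 * n + 1)) - 1) = -((2 : ℕ) : ZMod _) := by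
      push_cast
      ring
    rw [h3]
    exact h2.neg
  mem_of_closed A h0 h1 _ y := by
    rw [← ZMod.natCast_zmod_val y]
    generalize y.val = m
    induction m with
    | zero => simpa using h0
    | succ m ih => simpa using h1 _ ih

end Dihedral

/-! ### The Frobenius groups -/

section Frobenius

open Polynomial

lemma frobeniusPerm₂_val (p r : ℕ) (hr : 0 < r) (i : Fin (p ^ r)) :
    (frobeniusPerm₂ p r hr i : ℕ) = ((i : ℕ) % p + 1) % p + p * (i / p) := by
  have hp : 0 < p := Nat.pos_of_ne_zero fun h => by
    subst h; simpa [hr.ne'] using i.2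
  obtain ⟨p, rfl⟩ := Nat.exists_eq_add_one_of_ne_zero hp.ne'
  simp [frobeniusPerm₂, Equiv.permCongr_apply, Fin.val_add]

/-- The block shift increments the lowest base-`p` digit without carry, as addition of `1` does to
the constant coefficient. -/
lemma frobeniusPerm₂_finFunctionFinEquiv (p r : ℕ) [NeZero p] (hr : 0 < r) (f f' : Fin r → Fin p)
    (h0 : f' ⟨0, hr⟩ = f ⟨0, hr⟩ + 1) (h : ∀ i : Fin r, (i : ℕ) ≠ 0 → f' i = f i) :
    frobeniusPerm₂ p r hr (finFunctionFinEquiv f) = finFunctionFinEquiv f' := by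
  obtain ⟨r, rfl⟩ := Nat.exists_eq_add_one_of_ne_zero hr.ne'
  have hp : 0 < p := Nat.pos_of_neZero p
  have key : ∀ f : Fin (r + 1) → Fin p, (finFunctionFinEquiv f : ℕ)
      = f 0 + p * ∑ i : Fin r, (f i.succ : ℕ) * p ^ (i : ℕ) := fun f => by
    rw [finFunctionFinEquiv_apply, Fin.sum_univ_succ, Finset.mul_sum]
    simp only [Fin.val_zero, pow_zero, mul_one, Fin.val_succ, pow_succ]
    congr 1
    exact Finset.sum_congr rfl fun i _ => by ring
  ext
  rw [frobeniusPerm₂_val, key, key, Nat.add_mul_mod_self_left, Nat.add_mul_div_left _ _ hp,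
    Nat.mod_eq_of_lt (f 0).2, Nat.div_eq_of_lt (f 0).2, zero_add]
  have h0' : f' 0 = f 0 + 1 := h0
  rw [h0', Fin.val_add, Fin.coe_ofNat_eq_mod, Nat.add_mod_mod,
    Finset.sum_congr rfl fun i _ => by rw [← h i.succ (by simp)]]

lemma frobeniusPerm₂_lab (p : ℕ) [Fact p.Prime] {h : (ZMod p)[X]} (hm : h.Monic)
    (hr : 0 < h.natDegree) (y : AdjoinRoot h) :
    frobeniusPerm₂ p h.natDegree hr (lab p hm y) = lab p hm (y + 1) := by
  -- Positive degree of `h` makes `1` its own remainder, with only a constant coefficient.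
  have h1 : AdjoinRoot.modByMonicHom hm 1 = 1 := by
    rw [← map_one (AdjoinRoot.mk h), AdjoinRoot.modByMonicHom_mk,
      Polynomial.modByMonic_eq_self_iff hm]
    simpa using Polynomial.natDegree_pos_iff_degree_pos.1 hr
  have hc : ∀ i : Fin h.natDegree, (AdjoinRoot.powerBasisAux' hm).equivFun (y + 1) i
      = (AdjoinRoot.powerBasisAux' hm).equivFun y i + if (i : ℕ) = 0 then 1 else 0 := fun i => by
    rw [map_add, Pi.add_apply]
    congr 1
    change (AdjoinRoot.modByMonicHom hm 1).coeff i = _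
    rw [h1, Polynomial.coeff_one]
  refine frobeniusPerm₂_finFunctionFinEquiv p _ hr _ _ ?_ fun i hi => ?_
  · change (ZMod.finEquiv p).symm _ = (ZMod.finEquiv p).symm _ + 1
    rw [← map_one (ZMod.finEquiv p).symm, ← map_add]
    exact congrArg _ ((hc _).trans (by simp))
  · change (ZMod.finEquiv p).symm _ = (ZMod.finEquiv p).symm _
    exact congrArg _ ((hc _).trans (by simp [hi]))

lemma isAffinePair_frobenius (p : ℕ) [Fact p.Prime] {h : (ZMod p)[X]} (hm : h.Monic)
    (hr : 0 < h.natDegree) (Γ : (AdjoinRoot h)ˣ) (hp : p ≠ 2) (hirr : Irreducible h)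
    (hΓ : ∀ u : (AdjoinRoot h)ˣ, u ∈ Subgroup.zpowers Γ) :
    IsAffinePair Γ (lab p hm).symm (frobeniusPerm₁ p hm Γ) (frobeniusPerm₂ p h.natDegree hr) where
  apply_mul i := by simp [frobeniusPerm₁, Equiv.permCongr_apply]
  apply_add_one i := by
    rw [Equiv.symm_apply_eq, ← frobeniusPerm₂_lab p hm hr, Equiv.apply_symm_apply]
  isUnit_zpow_sub_one k hk := by
    have : Fact (Irreducible h) := ⟨hirr⟩
    rw [isUnit_iff_ne_zero, sub_ne_zero]
    intro h1
    have h2 : Γ ^ k = 1 := Units.ext h1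
    have : Finite (AdjoinRoot h) := Finite.of_equiv _ (lab p hm).symm
    have h3 : (Nat.card (AdjoinRoot h)ˣ : ℤ) ∣ k := by
      rw [← orderOf_eq_card_of_forall_mem_zpowers hΓ]
      exact orderOf_dvd_iff_zpow_eq_one.2 h2
    rw [Nat.card_units, Nat.card_congr (lab p hm), Nat.card_fin] at h3
    -- The order `p ^ r - 1` of `Γ` is even since `p` is odd, so an odd power of `Γ` is never `1`.
    have h4 : Even (p ^ h.natDegree - 1) :=
      Nat.Odd.sub_odd ((Fact.out : p.Prime).odd_of_ne_two hp).pow odd_one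
    have h5 : (2 : ℤ) ∣ k := dvd_trans (by exact_mod_cast h4.two_dvd) h3
    exact (Int.not_even_iff_odd.2 hk) (even_iff_two_dvd.2 h5)
  mem_of_closed A h0 h1 h2 y := by
    have : Fact (Irreducible h) := ⟨hirr⟩
    have : Finite (AdjoinRoot h) := Finite.of_equiv _ (lab p hm).symm
    rcases eq_or_ne y 0 with rfl | hy
    · exact h0
    -- Finiteness gives a natural exponent, so `y` is reached from `1 = 0 + 1` by repeated
    -- multiplication by `Γ`.
    · obtain ⟨m, hm⟩ := mem_powers_iff_mem_zpowers.2 (hΓ (Units.mk0 y hy))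
      have hy' : y = (Γ : AdjoinRoot h) ^ m := by
        rw [← Units.val_pow_eq_pow_val]
        exact (congrArg Units.val hm).symm
      rw [hy']
      clear hm hy'
      induction m with
      | zero => simpa using h1 0 h0
      | succ m ih => rw [pow_succ']; exact h2 _ ih

end Frobenius

end ConicBundle

open ConicBundle Polynomial in
theorem mainTheorem6 :
    (∀ n₁ n₂ : ℕ, 0 < n₁ → 0 < n₂ →
      IsDirectProduct (dihedral n₁) (dihedral n₂) ∧
      gluedProduct (dihedral n₁) (dihedral n₂) ≤ WD _ ∧
      SatisfiesH1 ((gluedProduct (dihedral n₁) (dihedral n₂)).subgroupOf (WD _)) ∧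
      IsRelativelyMinimal ((gluedProduct (dihedral n₁) (dihedral n₂)).subgroupOf (WD _))) ∧
    (∀ (n : ℕ) (p : ℕ) [Fact p.Prime] (h : (ZMod p)[X]) (hm : h.Monic) (hr : 0 < h.natDegree)
      (Γ : (AdjoinRoot h)ˣ), 0 < n → p ≠ 2 → Irreducible h →
      (∀ u : (AdjoinRoot h)ˣ, u ∈ Subgroup.zpowers Γ) →
      IsDirectProduct (dihedral n) (frobenius p hm hr Γ) ∧
      gluedProduct (dihedral n) (frobenius p hm hr Γ) ≤ WD _ ∧
      SatisfiesH1 ((gluedProduct (dihedral n) (frobenius p hm hr Γ)).subgroupOf (WD _)) ∧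
      IsRelativelyMinimal
        ((gluedProduct (dihedral n) (frobenius p hm hr Γ)).subgroupOf (WD _))) := by
  have hodd : ∀ n : ℕ, Odd (Nat.card (Fin (2 * n + 1))) := fun n => by simp
  refine ⟨fun n₁ n₂ _ _ => ?_, fun n p _ h hm hr Γ _ hp hirr hΓ => ?_⟩
  · exact (isAffinePair_dihedral n₁).gluedProduct (hodd n₁) (hodd n₂) (isAffinePair_dihedral n₂)
      rfl rfl
  · refine (isAffinePair_dihedral n).gluedProduct (hodd n) ?_
      (isAffinePair_frobenius p hm hr Γ hp hirr hΓ) rfl rfl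
    rw [Nat.card_fin]
    exact ((Fact.out : p.Prime).odd_of_ne_two hp).pow
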